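/- Let $m\ge 2$ and let $E_1,\dots,E_m$ be real Banach lattices. An ($m$-)linear operator between Banach lattices is called regular if it is the difference of two positive ($m$-)linear operators, and a linear operator is called weakly compact if it maps the closed unit ball to a relatively weakly compact set. Suppose that: (i) for all $2\le j<k\le m$, every regular linear operator from $E_j$ to $E_k^{*}$ is weakly compact; (ii) for every $k=2,\dots,m$, every $x_1^{**}\in E_1^{**}$ and every regular linear operator $T\colon E_1\to E_k^{*}$, the functional $T^{**}(x_1^{**})\in E_k^{***}$ is order continuous on $E_k^{**}$. Then, for every Banach lattice $F$ and every regular $m$-linear operator $A\colon E_1\times\cdots\times E_m\to F$, the Arens extension $A^{*[m+1]}\colon E_1^{**}\times\cdots\times E_m^{**}\to F^{**}$ is separately order continuous on $E_1^{**}\times\cdots\times E_m^{**}$, that is, for each $j$ and all fixed $x_i^{**}\in E_i^{**}$, $i\ne j$, the linear operator $x_j^{**}\mapsto A^{*[m+1]}(x_1^{**},\dots,x_m^{**})$ from $E_j^{**}$ to $F^{**}$ is order continuous. Here a net $(x_\alpha)_{\alpha\in\Omega}$ in a Riesz space is order convergent to $0$ if there is a net $(y_\alpha)_{\alpha\in\Omega}$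 with $y_\alpha\downarrow 0$ and $|x_\alpha|\le y_\alpha$ for all $\alpha$, and a linear operator is order continuous if it maps nets that are order convergent to $0$ to nets that are order convergent to $0$. The Arens extension is defined by $$A^{*[m+1]}(x_1^{**},\dots,x_m^{**})(y^{*})=\big(\overline{x_1^{**}}\circ\cdots\circ\overline{x_m^{**}}\big)(y^{*}\circ A)\qquad (y^{*}\in F^{*}),$$ where $\overline{x_k^{**}}$ sends a regular form $B$ on $E_1\times\cdots\times E_k$ to the form $(x_1,\dots,x_{k-1})\mapsto x_k^{**}\big(B(x_1,\dots,x_{k-1},\bullet)\big)$ on $E_1\times\cdots\times E_{k-1}$ (for $k=1$, to the number $x_1^{**}(B)$). -/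

import Mathlib

namespace ArensExtension

/-- The order of the (topological) dual of an ordered normed space:
`f ≤ g` iff `f x ≤ g x` for all `x ≥ 0`. -/
instance strongDualPreorder {E : Type*} [SeminormedAddCommGroup E] [NormedSpace ℝ E]
    [Preorder E] : Preorder (StrongDual ℝ E) where
  le f g := ∀ x : E, 0 ≤ x → f x ≤ g x
  le_refl _ _ _ := le_rfl
  le_trans _ _ _ h₁ h₂ x hx := (h₁ x hx).trans (h₂ x hx)

/-- `E**` -/
abbrev Bidual (E : Type*) [SeminormedAddCommGroup E] [NormedSpace ℝ E] : Type _ :=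
  StrongDual ℝ (StrongDual ℝ E)

section Order

/-- The net `x` is order convergent to `0`: there is a net `y` with the same index set,
`y ↓ 0` and `|x i| ≤ y i` for all `i`. In a Riesz space (such as the dual of a Banach lattice)
`|u| ≤ v` means `u ≤ v` and `-u ≤ v`; see `orderNull_iff_abs`. -/
def OrderNull {ι X : Type*} [Preorder ι] [AddCommGroup X] [Preorder X] (x : ι → X) : Prop :=
  ∃ y : ι → X, Antitone y ∧ IsGLB (Set.range y) 0 ∧ ∀ i, x i ≤ y i ∧ -x i ≤ y i

theorem orderNull_iff_abs {ι X : Type*} [Preorder ι] [AddCommGroup X] [Lattice X] (x : ι → X) :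
    OrderNull x ↔ ∃ y : ι → X, Antitone y ∧ IsGLB (Set.range y) 0 ∧ ∀ i, |x i| ≤ y i := by
  simp only [OrderNull, abs_le']

/-- Order continuity of a (linear) map: it sends nets that are order convergent to `0` to nets
that are order convergent to `0`. The index sets of the nets range over the universe `w`. -/
def IsOrderContinuous.{w, a, b} {X : Type a} {Y : Type b} [AddCommGroup X] [Preorder X]
    [AddCommGroup Y] [Preorder Y] (T : X → Y) : Prop :=
  ∀ (ι : Type w) [Preorder ι] [IsDirectedOrder ι] [Nonempty ι] (x : ι → X),
    OrderNull x → OrderNull fun i => T (x i)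

/-- Order continuity in each variable, the other variables being fixed. -/
def IsSeparatelyOrderContinuous.{w, a, b} {ι : Type*} [DecidableEq ι] {X : ι → Type a}
    {Y : Type b} [∀ i, AddCommGroup (X i)] [∀ i, Preorder (X i)] [AddCommGroup Y] [Preorder Y]
    (A : (∀ i, X i) → Y) : Prop :=
  ∀ (j : ι) (x : ∀ i, X i),
    IsOrderContinuous.{w} fun z : X j => A (Function.update x j z)

end Order

section Linear

variable {E G : Type*} [NormedAddCommGroup E] [NormedSpace ℝ E]
  [NormedAddCommGroup G] [NormedSpace ℝ G]

/-- Regular linear operators: differences of two positive ones. (Positive operators between Banach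
lattices are automatically bounded.) -/
def IsRegularLinear [Preorder E] [Preorder G] (T : E →L[ℝ] G) : Prop :=
  ∃ P Q : E →L[ℝ] G, (∀ x, 0 ≤ x → 0 ≤ P x) ∧ (∀ x, 0 ≤ x → 0 ≤ Q x) ∧ T = P - Q

/-- Weakly compact operators: the image of the closed unit ball is relatively compact in the weak
topology. -/
def IsWeaklyCompactOperator (T : E →L[ℝ] G) : Prop :=
  IsCompact (closure ((fun x => toWeakSpace ℝ G (T x)) '' Metric.closedBall (0 : E) 1))

/-- The adjoint `T* : G* → E*`, `T* g = g ∘ T`. -/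
noncomputable def adjoint (T : E →L[ℝ] G) : StrongDual ℝ G →L[ℝ] StrongDual ℝ E :=
  ContinuousLinearMap.precomp ℝ T

/-- The second adjoint `T** : E** → G**`. -/
noncomputable def biadjoint (T : E →L[ℝ] G) : Bidual E →L[ℝ] Bidual G :=
  adjoint (adjoint T)

end Linear

section Multilinear

/-- Positive multilinear operators. -/
def IsPositiveMultilinear {ι : Type*} {E : ι → Type*} {F : Type*}
    [∀ i, AddCommGroup (E i)] [∀ i, Module ℝ (E i)] [∀ i, Preorder (E i)]
    [AddCommGroup F] [Module ℝ F] [Preorder F] (A : MultilinearMap ℝ E F) : Prop :=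
  ∀ x, (∀ i, 0 ≤ x i) → 0 ≤ A x

/-- Regular multilinear operators: differences of two positive ones. -/
def IsRegularMultilinear {ι : Type*} {E : ι → Type*} {F : Type*}
    [∀ i, AddCommGroup (E i)] [∀ i, Module ℝ (E i)] [∀ i, Preorder (E i)]
    [AddCommGroup F] [Module ℝ F] [Preorder F] (A : MultilinearMap ℝ E F) : Prop :=
  ∃ P Q : MultilinearMap ℝ E F, IsPositiveMultilinear P ∧ IsPositiveMultilinear Q ∧ A = P - Q

section Continuity

variable {ι : Type*} [Fintype ι] {E : ι → Type*} {F : Type*}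
  [∀ i, NormedAddCommGroup (E i)] [∀ i, NormedSpace ℝ (E i)] [∀ i, Lattice (E i)]
  [∀ i, IsOrderedAddMonoid (E i)] [∀ i, IsOrderedModule ℝ (E i)] [∀ i, HasSolidNorm (E i)]
  [NormedAddCommGroup F] [NormedSpace ℝ F] [Lattice F]
  [IsOrderedAddMonoid F] [HasSolidNorm F]

set_option linter.unusedSectionVars false in
theorem IsPositiveMultilinear.mono {A : MultilinearMap ℝ E F} (hA : IsPositiveMultilinear A)
    {x y : ∀ i, E i} (hx : ∀ i, 0 ≤ x i) (hxy : ∀ i, x i ≤ y i) : A x ≤ A y := by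
  classical
  have h := A.map_add_univ x (y - x)
  rw [add_sub_cancel] at h
  rw [h]
  have h1 : A x = A ((Finset.univ : Finset ι).piecewise x (y - x)) := by simp
  rw [h1]
  refine Finset.single_le_sum (f := fun s : Finset ι => A (s.piecewise x (y - x)))
    (fun s _ => hA _ fun i => ?_) (Finset.mem_univ _)
  by_cases hi : i ∈ s
  · simpa [hi] using hx i
  · simpa [hi] using hxy i

theorem IsPositiveMultilinear.bounded_on_positive [∀ i, CompleteSpace (E i)]
    {A : MultilinearMap ℝ E F} (hA : IsPositiveMultilinear A) :
    ∃ C : ℝ, ∀ x : ∀ i, E i, (∀ i, 0 ≤ x i) → (∀ i, ‖x i‖ ≤ 1) → ‖A x‖ ≤ C := by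
  by_contra! hcon
  choose x hx0 hx1 hx using fun n : ℕ => hcon (n * (2 ^ n) ^ Fintype.card ι)
  have hsum : ∀ i, Summable fun n : ℕ => ((1 / 2 : ℝ) ^ n) • x n i := fun i => by
    refine Summable.of_norm_bounded summable_geometric_two fun n => ?_
    rw [norm_smul, Real.norm_of_nonneg (by positivity)]
    exact mul_le_of_le_one_right (by positivity) (hx1 n i)
  let z : ∀ i, E i := fun i => ∑' n : ℕ, ((1 / 2 : ℝ) ^ n) • x n i
  have hpos : ∀ (n : ℕ) i, 0 ≤ ((1 / 2 : ℝ) ^ n) • x n i := fun n i =>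
    smul_nonneg (by positivity) (hx0 n i)
  have key : ∀ n : ℕ, (n : ℝ) ≤ ‖A z‖ := fun n => by
    have h1 : A (fun i => ((1 / 2 : ℝ) ^ n) • x n i) ≤ A z :=
      hA.mono (hpos n) fun i => (hsum i).le_tsum n fun k _ => hpos k i
    have h0 : 0 ≤ A (fun i => ((1 / 2 : ℝ) ^ n) • x n i) := hA _ (hpos n)
    have h2 : ‖A (fun i => ((1 / 2 : ℝ) ^ n) • x n i)‖ ≤ ‖A z‖ :=
      HasSolidNorm.solid (by rwa [abs_of_nonneg h0, abs_of_nonneg (h0.trans h1)])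
    rw [A.map_smul_univ (fun _ => (1 / 2 : ℝ) ^ n) (x n), norm_smul] at h2
    refine le_trans ?_ h2
    rw [Finset.prod_const, Finset.card_univ, Real.norm_of_nonneg (by positivity)]
    have h3 := (hx n).le
    calc (n : ℝ) = ((1 / 2 : ℝ) ^ n) ^ Fintype.card ι * (n * (2 ^ n) ^ Fintype.card ι) := by
          rw [mul_left_comm, ← mul_pow, ← mul_pow]; norm_num
      _ ≤ _ := by gcongr
  obtain ⟨n, hn⟩ := exists_nat_gt ‖A z‖
  exact absurd (key n) (not_le.mpr hn)

theorem IsPositiveMultilinear.continuous [∀ i, CompleteSpace (E i)]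
    {A : MultilinearMap ℝ E F} (hA : IsPositiveMultilinear A) : Continuous A := by
  classical
  obtain ⟨C, hC⟩ := hA.bounded_on_positive
  have hb : ∀ x : ∀ i, E i, (∀ i, ‖x i‖ ≤ 1) → ‖A x‖ ≤ Fintype.card (Finset ι) * C := by
    intro x hx
    have h := A.map_add_univ (fun i => (x i)⁺) (fun i => -(x i)⁻)
    have e : ((fun i => (x i)⁺) + fun i => -(x i)⁻) = x := by
      funext i
      simp only [Pi.add_apply, ← sub_eq_add_neg, posPart_sub_negPart]
    rw [e] at h
    rw [h]
    have hs : ∀ s : Finset ι, ‖A (s.piecewise (fun i => (x i)⁺) fun i => -(x i)⁻)‖ ≤ C := by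
      intro s
      have e2 : (s.piecewise (fun i => (x i)⁺) fun i => -(x i)⁻) =
          fun i => (if i ∈ s then (1 : ℝ) else -1) •
            (s.piecewise (fun i => (x i)⁺) (fun i => (x i)⁻)) i := by
        funext i
        by_cases hi : i ∈ s <;> simp [hi]
      rw [e2, A.map_smul_univ, norm_smul, norm_prod]
      have e3 : ∏ i, ‖(if i ∈ s then (1 : ℝ) else -1)‖ = 1 :=
        Finset.prod_eq_one fun i _ => by split_ifs <;> simp
      rw [e3, one_mul]
      refine hC _ (fun i => ?_) fun i => ?_
      · by_cases hi : i ∈ s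
        · simp [hi]
        · simp [hi]
      · refine le_trans (HasSolidNorm.solid ?_) (hx i)
        by_cases hi : i ∈ s
        · simp only [hi, Finset.piecewise_eq_of_mem, abs_of_nonneg (posPart_nonneg (x i))]
          exact sup_le (le_abs_self _) (abs_nonneg _)
        · simp only [hi, not_false_eq_true, Finset.piecewise_eq_of_notMem,
            abs_of_nonneg (negPart_nonneg (x i))]
          exact sup_le (neg_le_abs _) (abs_nonneg _)
    calc _ ≤ ∑ s : Finset ι, ‖A (s.piecewise (fun i => (x i)⁺) fun i => -(x i)⁻)‖ :=
          norm_sum_le _ _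
      _ ≤ ∑ _s : Finset ι, C := Finset.sum_le_sum fun s _ => hs s
      _ = _ := by simp
  refine A.continuous_of_bound (Fintype.card (Finset ι) * C) fun x => ?_
  by_cases h0 : ∃ i, x i = 0
  · obtain ⟨i, hi⟩ := h0
    rw [A.map_coord_zero i hi, Finset.prod_eq_zero (Finset.mem_univ i) (by rw [hi, norm_zero])]
    simp
  · push Not at h0
    have e : x = fun i => ‖x i‖ • (‖x i‖⁻¹ • x i) := by
      funext i
      rw [smul_smul, mul_inv_cancel₀ (norm_ne_zero_iff.mpr (h0 i)), one_smul]
    have h1 := hb (fun i => ‖x i‖⁻¹ • x i) fun i => by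
      rw [norm_smul, norm_inv, norm_norm, inv_mul_cancel₀ (norm_ne_zero_iff.mpr (h0 i))]
    rw [e, A.map_smul_univ, ← e, norm_smul, norm_prod]
    simp only [norm_norm]
    rw [mul_comm]
    gcongr

theorem IsRegularMultilinear.continuous [∀ i, CompleteSpace (E i)]
    {A : MultilinearMap ℝ E F} (hA : IsRegularMultilinear A) : Continuous A := by
  obtain ⟨P, Q, hP, hQ, rfl⟩ := hA
  exact hP.continuous.sub hQ.continuous

/-- A regular multilinear operator between Banach lattices, as a bounded multilinear operator. -/
def IsRegularMultilinear.toContinuous [∀ i, CompleteSpace (E i)]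
    {A : MultilinearMap ℝ E F} (hA : IsRegularMultilinear A) : ContinuousMultilinearMap ℝ E F :=
  { A with cont := hA.continuous }

end Continuity

section Arens

/-- For `φ ∈ E_{n+1}**`, the operator that sends a form `B` on `E_1 × ⋯ × E_{n+1}` to the form
`(x_1, …, x_n) ↦ φ (B (x_1, …, x_n, •))` on `E_1 × ⋯ × E_n`. -/
noncomputable def contractLast {n : ℕ} {E : Fin (n + 1) → Type*}
    [∀ i, NormedAddCommGroup (E i)] [∀ i, NormedSpace ℝ (E i)] (φ : Bidual (E (Fin.last n))) :
    ContinuousMultilinearMap ℝ E ℝ →L[ℝ]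
      ContinuousMultilinearMap ℝ (fun i : Fin n => E i.castSucc) ℝ :=
  (ContinuousLinearMap.compContinuousMultilinearMapL ℝ (fun i : Fin n => E i.castSucc)
      (StrongDual ℝ (E (Fin.last n))) ℝ φ).comp
    (continuousMultilinearCurryRightEquiv ℝ E ℝ).toContinuousLinearEquiv.toContinuousLinearMap

theorem contractLast_apply {n : ℕ} {E : Fin (n + 1) → Type*}
    [∀ i, NormedAddCommGroup (E i)] [∀ i, NormedSpace ℝ (E i)] (φ : Bidual (E (Fin.last n)))
    (B : ContinuousMultilinearMap ℝ E ℝ) (x : ∀ i : Fin n, E i.castSucc) :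
    contractLast φ B x = φ (B.curryRight x) := rfl

/-- The functional that sends an `m`-linear form `B` to `B^{*[m+1]} (φ_1, …, φ_m)`: contract the
last variable of `B` with `φ_m`, then the last remaining variable with `φ_{m-1}`, and so on, ending
with `φ_1`. -/
noncomputable def arensForm : (m : ℕ) → {E : Fin m → Type*} →
    [∀ i, NormedAddCommGroup (E i)] → [∀ i, NormedSpace ℝ (E i)] → (∀ i, Bidual (E i)) →
    ContinuousMultilinearMap ℝ E ℝ →L[ℝ] ℝ
  | 0, E, _, _, _ => ContinuousMultilinearMap.apply ℝ E ℝ fun i => i.elim0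
  | n + 1, _, _, _, φ =>
    (arensForm n fun i : Fin n => φ i.castSucc).comp (contractLast (φ (Fin.last n)))

/-- The Arens extension `A^{*[m+1]} : E_1** × ⋯ × E_m** → F**` of `A : E_1 × ⋯ × E_m → F`,
`A^{*[m+1]} (φ_1, …, φ_m) (y') = (y' ∘ A)^{*[m+1]} (φ_1, …, φ_m)` for `y' ∈ F*`. -/
noncomputable def arensExtension {m : ℕ} {E : Fin m → Type*} {F : Type*}
    [∀ i, NormedAddCommGroup (E i)] [∀ i, NormedSpace ℝ (E i)]
    [NormedAddCommGroup F] [NormedSpace ℝ F] (A : ContinuousMultilinearMap ℝ E F)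
    (φ : ∀ i, Bidual (E i)) : Bidual F :=
  (arensForm m φ).comp
    ((ContinuousLinearMap.compContinuousMultilinearMapL ℝ E F ℝ).flip A)

theorem arensExtension_apply {m : ℕ} {E : Fin m → Type*} {F : Type*}
    [∀ i, NormedAddCommGroup (E i)] [∀ i, NormedSpace ℝ (E i)]
    [NormedAddCommGroup F] [NormedSpace ℝ F] (A : ContinuousMultilinearMap ℝ E F)
    (φ : ∀ i, Bidual (E i)) (y' : StrongDual ℝ F) :
    arensExtension A φ y' = arensForm m φ (y'.compContinuousMultilinearMap A) := rfl

end Arens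

end Multilinear

end ArensExtension

open ArensExtension

universe u v w

namespace ArensExtension

/-! ### Order structure of duals: Riesz–Kantorovich without a lattice instance -/

section StrongDualOrder

/-! Everything reduces to positive data: a regular operator is a difference of positive ones, and
each fixed functional in a bidual is a difference of positive functionals. A positive operator into
a dual space is order continuous as soon as nets decreasing to 0 become arbitrarily small at every
positive point (`isOrderContinuous_of_exists_apply_lt`), so it suffices to study the positive scalar
form `B = y* ∘ A`.

The variables after the `j`-th are contracted first, with positive functionals, which leaves a
positive form whose last variable is the `j`-th. If `j` is the first variable, this form is a
positive element of `E_1*`, and a net decreasing to 0 in `E_1**` tends to 0 on it. Otherwise the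
moving functional `ψ` is applied before those of the earlier variables, and the order of contraction
has to be changed. A weakly compact `T : E_i → E_j*` satisfies `T**(E_i**) ⊆ E_j*`, which says
exactly that `φ_i` and `ψ` may be exchanged. Hypothesis (i) thus lets every `φ_i` with `2 ≤ i < j`
act before `ψ` (`exists_arensForm_comp_eq`). What is left is `φ_1 (ψ ∘ T) = T**(φ_1)(ψ)` with `T :
E_1 → E_j*` positive, which hypothesis (ii) controls. Since `φ_1` is never exchanged with `ψ`, no
compactness is needed for operators on `E_1`.

Duals are treated through `HasBoundedPosParts`, a property that passes to the dual and so can be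
iterated. -/

instance strongDualIsOrderedAddMonoid {E : Type*} [SeminormedAddCommGroup E] [NormedSpace ℝ E]
    [Preorder E] : IsOrderedAddMonoid (StrongDual ℝ E) where
  add_le_add_left _ _ h c x hx := add_le_add_left (h x hx) (c x)

/-- An ordered normed space in which every element `x` has a positive part `x ⊔ 0`, of norm
controlled by the norm of `x`, and in which order intervals `[0, x]` are bounded in terms of the
norm of `x`. Banach lattices and all their iterated duals have this property. -/
structure HasBoundedPosParts (X : Type*) [NormedAddCommGroup X] [Preorder X] : Prop where
  exists_posPart : ∃ C : ℝ, ∀ x : X, ∃ p, 0 ≤ p ∧ x ≤ p ∧ ‖p‖ ≤ C * ‖x‖ ∧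
    ∀ q, 0 ≤ q → x ≤ q → p ≤ q
  exists_norm_le : ∃ C : ℝ, ∀ u x : X, 0 ≤ u → u ≤ x → ‖u‖ ≤ C * ‖x‖

theorem hasBoundedPosParts_of_hasSolidNorm {E : Type*} [NormedAddCommGroup E] [Lattice E]
    [IsOrderedAddMonoid E] [HasSolidNorm E] : HasBoundedPosParts E where
  exists_posPart := by
    refine ⟨1, fun x => ⟨x⁺, posPart_nonneg x, le_posPart x, ?_, fun q hq hx => sup_le hx hq⟩⟩
    rw [one_mul]
    refine HasSolidNorm.solid ?_
    rw [abs_of_nonneg (posPart_nonneg x)]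
    exact sup_le (le_abs_self x) (abs_nonneg x)
  exists_norm_le := by
    refine ⟨1, fun u x hu hx => ?_⟩
    rw [one_mul]
    refine HasSolidNorm.solid ?_
    rwa [abs_of_nonneg hu, abs_of_nonneg (hu.trans hx)]

namespace HasBoundedPosParts

variable {X : Type*} [NormedAddCommGroup X] [Preorder X] [IsOrderedAddMonoid X]

theorem exists_sub (hX : HasBoundedPosParts X) : ∃ C : ℝ, 0 ≤ C ∧ ∀ x : X, ∃ p q, 0 ≤ p ∧ 0 ≤ q ∧
    x = p - q ∧ ‖p‖ ≤ C * ‖x‖ ∧ ‖q‖ ≤ C * ‖x‖ := by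
  obtain ⟨C, hC⟩ := hX.exists_posPart
  refine ⟨|C| + 1, by positivity, fun x => ?_⟩
  obtain ⟨p, hp, hxp, hn, -⟩ := hC x
  have h1 : C * ‖x‖ ≤ |C| * ‖x‖ := by gcongr; exact le_abs_self C
  have h2 := norm_sub_le p x
  have h3 := norm_nonneg x
  refine ⟨p, p - x, hp, sub_nonneg.2 hxp, by abel, ?_, ?_⟩ <;> linarith

/-- The summand below `y` is the positive part of `u - x`; its minimality among positive upper
bounds gives both `p ≤ u` and `p ≤ y`. -/
theorem exists_riesz_decomposition (hX : HasBoundedPosParts X) {u x y : X} (hu : 0 ≤ u)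
    (hy : 0 ≤ y) (hx : 0 ≤ x) (h : u ≤ x + y) :
    ∃ a b, 0 ≤ a ∧ a ≤ x ∧ 0 ≤ b ∧ b ≤ y ∧ u = a + b := by
  obtain ⟨C, hC⟩ := hX.exists_posPart
  obtain ⟨p, hp, hxp, -, hmin⟩ := hC (u - x)
  refine ⟨u - p, p, sub_nonneg.2 (hmin u hu (sub_le_self u hx)), sub_le_comm.1 hxp, hp,
    hmin y hy (sub_le_iff_le_add'.2 h), by abel⟩

variable [NormedSpace ℝ X]

/-- Kantorovich extension: an additive function on the cone extends by differences, and norm control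
of the decomposition makes the extension bounded. Homogeneity is not assumed because a continuous
additive map is real linear. -/
theorem exists_extension (hX : HasBoundedPosParts X) : ∃ K : ℝ, ∀ (g : X → ℝ) (M : ℝ),
    (∀ x y, 0 ≤ x → 0 ≤ y → g (x + y) = g x + g y) → (∀ x, 0 ≤ x → |g x| ≤ M * ‖x‖) →
    ∃ G : StrongDual ℝ X, (∀ x, 0 ≤ x → G x = g x) ∧ ‖G‖ ≤ K * |M| := by
  obtain ⟨C, hC0, hC⟩ := hX.exists_sub
  choose p q hp hq hpq hpn hqn using hC
  refine ⟨2 * C, fun g M hadd hb => ?_⟩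
  -- The value on a difference does not depend on how it is written as a difference of positive
  -- elements.
  have key : ∀ a b c d : X, 0 ≤ a → 0 ≤ b → 0 ≤ c → 0 ≤ d → a - b = c - d →
      g a - g b = g c - g d := by
    intro a b c d ha hb' hc hd h
    have h1 := hadd a d ha hd
    have h2 := hadd c b hc hb'
    rw [sub_eq_sub_iff_add_eq_add.1 h] at h1
    linarith
  let G : X →+ ℝ := AddMonoidHom.mk' (fun x => g (p x) - g (q x)) fun x y => by
    have h := key (p (x + y)) (q (x + y)) (p x + p y) (q x + q y) (hp _) (hq _)
      (add_nonneg (hp _) (hp _)) (add_nonneg (hq _) (hq _)) (by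
        rw [← hpq, add_sub_add_comm, ← hpq, ← hpq])
    rw [h, hadd _ _ (hp x) (hp y), hadd _ _ (hq x) (hq y)]
    ring
  have hG : ∀ x, ‖G x‖ ≤ 2 * C * |M| * ‖x‖ := by
    intro x
    have h1 : ∀ z : X, 0 ≤ z → ‖z‖ ≤ C * ‖x‖ → |g z| ≤ |M| * (C * ‖x‖) := fun z hz hzn =>
      (hb z hz).trans (mul_le_mul (le_abs_self M) hzn (norm_nonneg z) (abs_nonneg M))
    calc ‖G x‖ ≤ |g (p x)| + |g (q x)| := abs_sub _ _
      _ ≤ |M| * (C * ‖x‖) + |M| * (C * ‖x‖) :=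
        add_le_add (h1 _ (hp x) (hpn x)) (h1 _ (hq x) (hqn x))
      _ = _ := by ring
  have hcont : Continuous G := AddMonoidHomClass.continuous_of_bound G _ hG
  refine ⟨G.toRealLinearMap hcont, fun x hx => ?_,
    ContinuousLinearMap.opNorm_le_bound _ (by positivity) hG⟩
  have h0 : g 0 = 0 := by simpa using hadd 0 0 le_rfl le_rfl
  have h := key (p x) (q x) x 0 (hp x) (hq x) hx le_rfl (by rw [← hpq, sub_zero])
  rw [h0, sub_zero] at h
  exact h

/-- Riesz–Kantorovich formula `f⁺ x = sup {f u | 0 ≤ u ≤ x}` on the cone. Riesz decomposition makes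
the supremum additive, so it extends to a functional. -/
theorem exists_dual_posPart (hX : HasBoundedPosParts X) : ∃ C : ℝ, ∀ f : StrongDual ℝ X,
    ∃ p : StrongDual ℝ X, 0 ≤ p ∧ f ≤ p ∧ ‖p‖ ≤ C * ‖f‖ ∧ ∀ q, 0 ≤ q → f ≤ q → p ≤ q := by
  obtain ⟨N, hN⟩ := hX.exists_norm_le
  obtain ⟨K, hK⟩ := hX.exists_extension
  refine ⟨K * |N|, fun f => ?_⟩
  let S : X → Set ℝ := fun x => f '' Set.Icc 0 x
  have hbd : ∀ x, ∀ r ∈ S x, r ≤ ‖f‖ * N * ‖x‖ := by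
    rintro x _ ⟨u, hu, rfl⟩
    calc f u ≤ ‖f‖ * ‖u‖ := (le_abs_self _).trans (f.le_opNorm u)
      _ ≤ ‖f‖ * (N * ‖x‖) := by gcongr; exact hN u x hu.1 hu.2
      _ = _ := by ring
  have hba : ∀ x, BddAbove (S x) := fun x => ⟨_, hbd x⟩
  have h0 : ∀ x, 0 ≤ x → (0 : ℝ) ∈ S x := fun x hx => ⟨0, ⟨le_rfl, hx⟩, map_zero f⟩
  have hne : ∀ x, 0 ≤ x → (S x).Nonempty := fun x hx => ⟨0, h0 x hx⟩
  obtain ⟨p, hp, hpn⟩ := hK (fun x => sSup (S x)) (‖f‖ * N) (fun x y hx hy => by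
    refine le_antisymm (csSup_le (hne _ (add_nonneg hx hy)) ?_) ?_
    · rintro _ ⟨u, hu, rfl⟩
      obtain ⟨a, b, ha, hax, hb, hby, rfl⟩ := hX.exists_riesz_decomposition hu.1 hy hx hu.2
      rw [map_add]
      exact add_le_add (le_csSup (hba x) ⟨a, ⟨ha, hax⟩, rfl⟩) (le_csSup (hba y) ⟨b, ⟨hb, hby⟩, rfl⟩)
    · rw [← le_sub_iff_add_le]
      refine csSup_le (hne x hx) ?_
      rintro _ ⟨a, ha, rfl⟩
      rw [le_sub_comm]
      refine csSup_le (hne y hy) ?_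
      rintro _ ⟨b, hb, rfl⟩
      rw [le_sub_iff_add_le', ← map_add]
      exact le_csSup (hba _) ⟨a + b, ⟨add_nonneg ha.1 hb.1, add_le_add ha.2 hb.2⟩, rfl⟩)
    (fun x hx => by
      rw [abs_of_nonneg (le_csSup (hba x) (h0 x hx))]
      exact csSup_le (hne x hx) (hbd x))
  refine ⟨p, fun x hx => ?_, fun x hx => ?_, ?_, fun q hq hfq x hx => ?_⟩
  · rw [hp x hx]
    exact le_csSup (hba x) (h0 x hx)
  · rw [hp x hx]
    exact le_csSup (hba x) ⟨x, ⟨hx, le_rfl⟩, rfl⟩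
  · rw [abs_mul, abs_norm] at hpn
    linarith
  · rw [hp x hx]
    refine csSup_le (hne x hx) ?_
    rintro _ ⟨u, hu, rfl⟩
    have h1 : 0 ≤ q (x - u) := hq (x - u) (sub_nonneg.2 hu.2)
    rw [map_sub] at h1
    exact (hfq u hu.1).trans (sub_nonneg.1 h1)

/-- The dual version of the Riesz–Kantorovich theorem. -/
theorem strongDual (hX : HasBoundedPosParts X) : HasBoundedPosParts (StrongDual ℝ X) where
  exists_posPart := hX.exists_dual_posPart
  exists_norm_le := by
    obtain ⟨C, hC0, hC⟩ := hX.exists_sub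
    refine ⟨2 * C, fun u f hu huf => ContinuousLinearMap.opNorm_le_bound _ (by positivity)
      fun x => ?_⟩
    obtain ⟨p, q, hp, hq, rfl, hpn, hqn⟩ := hC x
    have h1 : ∀ z : X, 0 ≤ z → ‖z‖ ≤ C * ‖p - q‖ → |u z| ≤ ‖f‖ * (C * ‖p - q‖) := fun z hz hzn => by
      rw [abs_of_nonneg (hu z hz)]
      exact (huf z hz).trans (((le_abs_self _).trans (f.le_opNorm z)).trans (by gcongr))
    rw [map_sub]
    calc ‖u p - u q‖ ≤ |u p| + |u q| := abs_sub _ _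
      _ ≤ ‖f‖ * (C * ‖p - q‖) + ‖f‖ * (C * ‖p - q‖) := add_le_add (h1 _ hp hpn) (h1 _ hq hqn)
      _ = _ := by ring

/-- A decreasing net of functionals with infimum `0` converges to `0` at every positive point. -/
theorem exists_apply_lt (hX : HasBoundedPosParts X) {ι : Type*} [Preorder ι]
    [IsDirectedOrder ι] [Nonempty ι] {y : ι → StrongDual ℝ X} (hy : Antitone y)
    (hy0 : IsGLB (Set.range y) 0) {x : X} (hx : 0 ≤ x) {ε : ℝ} (hε : 0 < ε) :
    ∃ i, y i x < ε := by
  have hnn : ∀ i, ∀ z : X, 0 ≤ z → 0 ≤ y i z := fun i => hy0.1 ⟨i, rfl⟩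
  have hbb : ∀ z : X, 0 ≤ z → BddBelow (Set.range fun i => y i z) := fun z hz =>
    ⟨0, by rintro _ ⟨i, rfl⟩; exact hnn i z hz⟩
  obtain ⟨K, hK⟩ := hX.exists_extension
  obtain ⟨i₀⟩ := ‹Nonempty ι›
  -- The pointwise infimum of the net is additive on the cone because the index set is directed. Its
  -- extension `G` is a lower bound of the net, hence `G ≤ 0`.
  obtain ⟨G, hG, -⟩ := hK (fun z => ⨅ i, y i z) ‖y i₀‖ (fun a b ha hb => by
    refine le_antisymm ?_ (le_ciInf fun i => ?_)
    · rw [← sub_le_iff_le_add]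
      refine le_ciInf fun i => ?_
      rw [sub_le_comm]
      refine le_ciInf fun k => ?_
      rw [sub_le_iff_le_add']
      obtain ⟨n, hin, hkn⟩ := exists_ge_ge i k
      refine (ciInf_le (hbb _ (add_nonneg ha hb)) n).trans ?_
      rw [map_add]
      exact add_le_add (hy hin a ha) (hy hkn b hb)
    · rw [map_add]
      exact add_le_add (ciInf_le (hbb a ha) i) (ciInf_le (hbb b hb) i))
    (fun z hz => by
      rw [abs_of_nonneg (Real.iInf_nonneg fun i => hnn i z hz)]
      exact (ciInf_le (hbb z hz) i₀).trans ((le_abs_self _).trans ((y i₀).le_opNorm z)))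
  have hG0 : G ≤ 0 := hy0.2 (by
    rintro _ ⟨i, rfl⟩ z hz
    rw [hG z hz]
    exact ciInf_le (hbb z hz) i)
  have h := hG0 x hx
  rw [hG x hx] at h
  exact exists_lt_of_ciInf_lt (h.trans_lt hε)

end HasBoundedPosParts

end StrongDualOrder

/-! ### Weakly compact operators and exchange of two contractions -/

section WeaklyCompact

/-- Hahn–Banach in the weak-star topology, where every continuous functional is evaluation at a
vector. -/
theorem exists_separating_of_isCompact {V : Type*} [NormedAddCommGroup V] [NormedSpace ℝ V]
    {C : Set (WeakDual ℝ V)} (hC : IsCompact C) (hconv : Convex ℝ C) {f : WeakDual ℝ V}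
    (hf : f ∉ C) : ∃ (v : V) (s : ℝ), (∀ g ∈ C, g v < s) ∧ s < f v := by
  have : LocallyConvexSpace ℝ (WeakDual ℝ V) :=
    inferInstanceAs (LocallyConvexSpace ℝ (WeakBilin (topDualPairing ℝ V)))
  obtain ⟨l, s, hs, hl⟩ := geometric_hahn_banach_closed_point hconv hC.isClosed hf
  obtain ⟨v, rfl⟩ := LinearMap.dualEmbedding_surjective (topDualPairing ℝ V) l
  exact ⟨v, s, hs, hl⟩

/-- The second adjoint of a weakly compact operator takes its values in the original space. -/
theorem IsWeaklyCompactOperator.exists_biadjoint_eq {E Y : Type*} [NormedAddCommGroup E]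
    [NormedSpace ℝ E] [NormedAddCommGroup Y] [NormedSpace ℝ Y] {T : E →L[ℝ] Y}
    (hT : IsWeaklyCompactOperator T) (φ : Bidual E) :
    ∃ y : Y, ∀ ψ : StrongDual ℝ Y, φ (ψ.comp T) = ψ y := by
  let J : WeakSpace ℝ Y →ₗ[ℝ] WeakDual ℝ (StrongDual ℝ Y) :=
    (StrongDual.toWeakDual (𝕜 := ℝ) (E := StrongDual ℝ Y)).toLinearMap ∘ₗ
      (NormedSpace.inclusionInDoubleDual ℝ Y).toLinearMap ∘ₗ
        (toWeakSpace ℝ Y).symm.toLinearMap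
  have hJ : Continuous J := WeakDual.continuous_of_continuous_eval fun ψ =>
    WeakBilin.eval_continuous (topDualPairing ℝ Y).flip ψ
  -- `L '' K` is the canonical image of `‖φ‖ • K` in the bidual. It is weak-star compact and convex,
  -- and the goal is that it contains `T** φ`.
  let L : WeakSpace ℝ Y →ₗ[ℝ] WeakDual ℝ (StrongDual ℝ Y) := J ∘ₗ (‖φ‖ • LinearMap.id)
  have hL : Continuous L := hJ.comp (continuous_const_smul ‖φ‖)
  let K : Set (WeakSpace ℝ Y) :=
    closure ((fun x => toWeakSpace ℝ Y (T x)) '' Metric.closedBall (0 : E) 1)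
  have hKconv : Convex ℝ K := Convex.closure
    ((convex_closedBall (0 : E) 1).linear_image ((toWeakSpace ℝ Y).toLinearMap ∘ₗ T.toLinearMap))
  by_contra! hcon
  have hmem : StrongDual.toWeakDual (φ.comp (adjoint T)) ∉ L '' K := by
    rintro ⟨y, -, hy⟩
    obtain ⟨ψ, hψ⟩ := hcon (‖φ‖ • (toWeakSpace ℝ Y).symm y)
    exact hψ (DFunLike.congr_fun hy ψ).symm
  obtain ⟨ψ, s, hs, hφs⟩ :=
    exists_separating_of_isCompact (hT.image hL) (hKconv.linear_image L) hmem
  have hball : ∀ x : E, ‖x‖ ≤ 1 → ψ (‖φ‖ • T x) < s := fun x hx =>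
    hs _ ⟨_, subset_closure ⟨x, mem_closedBall_zero_iff.2 hx, rfl⟩, rfl⟩
  have hs0 : 0 ≤ s := by simpa using (hball 0 (by simp)).le
  -- The ball is symmetric, so the one-sided bound from separation is a norm bound; it gives `φ (ψ ∘
  -- T) ≤ ‖φ‖ ‖ψ ∘ T‖ ≤ s`, against the separation.
  have hnorm : ‖‖φ‖ • ψ.comp T‖ ≤ s :=
    ContinuousLinearMap.opNorm_le_of_unit_norm hs0 fun x hx => by
      have h1 := (hball x hx.le).le
      have h2 := (hball (-x) (by rw [norm_neg, hx])).le
      rw [map_neg, smul_neg, map_neg] at h2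
      rw [map_smul] at h1 h2
      exact abs_le'.2 ⟨h1, h2⟩
  rw [norm_smul, Real.norm_of_nonneg (ContinuousLinearMap.opNorm_nonneg φ)] at hnorm
  exact absurd hφs (not_lt.2 (((le_abs_self _).trans (φ.le_opNorm _)).trans hnorm))

/-- The two Arens extensions of the bilinear form of a weakly compact operator agree. -/
theorem IsWeaklyCompactOperator.apply_comp_comm {E G : Type*} [NormedAddCommGroup E]
    [NormedSpace ℝ E] [NormedAddCommGroup G] [NormedSpace ℝ G] {T : E →L[ℝ] StrongDual ℝ G}
    (hT : IsWeaklyCompactOperator T) (φ : Bidual E) (ψ : Bidual G) :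
    φ (ψ.comp T) = ψ (φ.comp T.flip) := by
  obtain ⟨y, hy⟩ := hT.exists_biadjoint_eq φ
  -- Testing `T** φ = y` on evaluations at points of `G` identifies `y`.
  have h : φ.comp T.flip = y := by
    ext g
    exact hy (NormedSpace.inclusionInDoubleDual ℝ G g)
  rw [h]
  exact hy ψ

end WeaklyCompact

/-! ### Regular operators obtained by fixing variables -/

section Multilinear

theorem IsRegularLinear.zero {E G : Type*} [NormedAddCommGroup E] [NormedSpace ℝ E]
    [NormedAddCommGroup G] [NormedSpace ℝ G] [Preorder E] [Preorder G] :
    IsRegularLinear (0 : E →L[ℝ] G) :=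
  ⟨0, 0, fun _ _ => le_rfl, fun _ _ => le_rfl, by simp⟩

theorem IsRegularLinear.of_nonneg {E G : Type*} [NormedAddCommGroup E] [NormedSpace ℝ E]
    [NormedAddCommGroup G] [NormedSpace ℝ G] [Preorder E] [Preorder G] {T : E →L[ℝ] G}
    (hT : ∀ x, 0 ≤ x → 0 ≤ T x) : IsRegularLinear T :=
  ⟨T, 0, hT, fun _ _ => le_rfl, by simp⟩

theorem IsRegularLinear.add {E G : Type*} [NormedAddCommGroup E] [NormedSpace ℝ E]
    [NormedAddCommGroup G] [NormedSpace ℝ G] [Preorder E] [Preorder G] [IsOrderedAddMonoid G]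
    {S T : E →L[ℝ] G} (hS : IsRegularLinear S) (hT : IsRegularLinear T) :
    IsRegularLinear (S + T) := by
  obtain ⟨P, Q, hP, hQ, rfl⟩ := hS
  obtain ⟨P', Q', hP', hQ', rfl⟩ := hT
  exact ⟨P + P', Q + Q', fun x hx => add_nonneg (hP x hx) (hP' x hx),
    fun x hx => add_nonneg (hQ x hx) (hQ' x hx), by abel⟩

theorem IsRegularLinear.neg {E G : Type*} [NormedAddCommGroup E] [NormedSpace ℝ E]
    [NormedAddCommGroup G] [NormedSpace ℝ G] [Preorder E] [Preorder G]
    {T : E →L[ℝ] G} (hT : IsRegularLinear T) : IsRegularLinear (-T) := by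
  obtain ⟨P, Q, hP, hQ, rfl⟩ := hT
  exact ⟨Q, P, hQ, hP, by abel⟩

/-- If a multilinear map with values in the operators is positive, all its values are regular. -/
theorem isRegularLinear_apply {ι : Type*} [Fintype ι] {E : ι → Type*}
    [∀ i, NormedAddCommGroup (E i)] [∀ i, NormedSpace ℝ (E i)] [∀ i, Lattice (E i)]
    [∀ i, IsOrderedAddMonoid (E i)] {X G : Type*} [NormedAddCommGroup X] [NormedSpace ℝ X]
    [Preorder X] [NormedAddCommGroup G] [NormedSpace ℝ G] [Preorder G] [IsOrderedAddMonoid G]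
    (S : MultilinearMap ℝ E (X →L[ℝ] G))
    (hS : ∀ x, (∀ i, 0 ≤ x i) → ∀ z, 0 ≤ z → 0 ≤ S x z) (x : ∀ i, E i) :
    IsRegularLinear (S x) := by
  classical
  have h := S.map_add_univ (fun i => (x i)⁺) (fun i => -(x i)⁻)
  have e : ((fun i => (x i)⁺) + fun i => -(x i)⁻) = x := by
    funext i
    simp only [Pi.add_apply, ← sub_eq_add_neg, posPart_sub_negPart]
  rw [e] at h
  rw [h]
  refine Finset.sum_induction _ IsRegularLinear (fun _ _ => IsRegularLinear.add)
    IsRegularLinear.zero fun s _ => ?_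
  -- The signs of the negative parts are pulled out, so each summand is `±1` times the value at a
  -- positive point.
  have e2 : (s.piecewise (fun i => (x i)⁺) fun i => -(x i)⁻) =
      fun i => (if i ∈ s then (1 : ℝ) else -1) •
        (s.piecewise (fun i => (x i)⁺) (fun i => (x i)⁻)) i := by
    funext i
    by_cases hi : i ∈ s <;> simp [hi]
  have hreg : IsRegularLinear (S (s.piecewise (fun i => (x i)⁺) (fun i => (x i)⁻))) :=
    .of_nonneg (hS _ fun i => by by_cases hi : i ∈ s <;> simp [hi])
  rw [e2, S.map_smul_univ]
  have hc : ∏ i, (if i ∈ s then (1 : ℝ) else -1) = 1 ∨ ∏ i, (if i ∈ s then (1 : ℝ) else -1) = -1 :=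
    Finset.prod_induction _ (fun c : ℝ => c = 1 ∨ c = -1)
      (by rintro _ _ (rfl | rfl) (rfl | rfl) <;> norm_num) (Or.inl rfl)
      fun i _ => by split_ifs <;> simp
  rcases hc with hc | hc <;> rw [hc]
  · rwa [one_smul]
  · rw [neg_one_smul]
    exact hreg.neg

end Multilinear

/-! ### Contractions of positive forms and the change of order -/

section Arens

theorem snoc_nonneg {n : ℕ} {E : Fin (n + 1) → Type*} [∀ i, Zero (E i)] [∀ i, Preorder (E i)]
    {x : ∀ i : Fin n, E i.castSucc} (hx : ∀ i, 0 ≤ x i) {z : E (Fin.last n)} (hz : 0 ≤ z)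
    (i : Fin (n + 1)) : 0 ≤ (Fin.snoc x z : ∀ i, E i) i := by
  refine Fin.lastCases ?_ (fun i => ?_) i
  · rwa [Fin.snoc_last]
  · rw [Fin.snoc_castSucc]
    exact hx i

theorem contractLast_nonneg {n : ℕ} {E : Fin (n + 1) → Type*}
    [∀ i, NormedAddCommGroup (E i)] [∀ i, NormedSpace ℝ (E i)] [∀ i, Preorder (E i)]
    {φ : Bidual (E (Fin.last n))} (hφ : 0 ≤ φ) {B : ContinuousMultilinearMap ℝ E ℝ}
    (hB : ∀ x, (∀ i, 0 ≤ x i) → 0 ≤ B x) (x : ∀ i : Fin n, E i.castSucc) (hx : ∀ i, 0 ≤ x i) :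
    0 ≤ contractLast φ B x :=
  hφ (B.curryRight x) fun _ hz => hB _ (snoc_nonneg hx hz)

theorem arensForm_succ {n : ℕ} {E : Fin (n + 1) → Type*} [∀ i, NormedAddCommGroup (E i)]
    [∀ i, NormedSpace ℝ (E i)] (φ : ∀ i, Bidual (E i)) (B : ContinuousMultilinearMap ℝ E ℝ) :
    arensForm (n + 1) φ B = arensForm n (Fin.init φ) (contractLast (φ (Fin.last n)) B) := rfl

theorem arensForm_nonneg {n : ℕ} {E : Fin n → Type*} [∀ i, NormedAddCommGroup (E i)]
    [∀ i, NormedSpace ℝ (E i)] [∀ i, Preorder (E i)] {φ : ∀ i, Bidual (E i)}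
    (hφ : ∀ i, 0 ≤ φ i) {B : ContinuousMultilinearMap ℝ E ℝ}
    (hB : ∀ x, (∀ i, 0 ≤ x i) → 0 ≤ B x) : 0 ≤ arensForm n φ B := by
  induction n with
  | zero => exact hB _ fun i => i.elim0
  | succ n ih => exact ih (fun i => hφ i.castSucc) (contractLast_nonneg (hφ _) hB)

theorem contractLast_sub {n : ℕ} {E : Fin (n + 1) → Type*} [∀ i, NormedAddCommGroup (E i)]
    [∀ i, NormedSpace ℝ (E i)] (φ ψ : Bidual (E (Fin.last n)))
    (B : ContinuousMultilinearMap ℝ E ℝ) :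
    contractLast (φ - ψ) B = contractLast φ B - contractLast ψ B := rfl

theorem arensForm_update_sub {n : ℕ} {E : Fin n → Type*} [∀ i, NormedAddCommGroup (E i)]
    [∀ i, NormedSpace ℝ (E i)] (φ : ∀ i, Bidual (E i)) (k : Fin n) (a b : Bidual (E k))
    (B : ContinuousMultilinearMap ℝ E ℝ) :
    arensForm n (Function.update φ k (a - b)) B =
      arensForm n (Function.update φ k a) B - arensForm n (Function.update φ k b) B := by
  induction n with
  | zero => exact k.elim0
  | succ n ih =>
    simp only [arensForm_succ]
    induction k using Fin.lastCases with
    | last => simp only [Fin.init_update_last, Function.update_self, contractLast_sub, map_sub]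
    | cast k =>
      simp only [Fin.init_update_castSucc]
      have h : ∀ c : Bidual (E k.castSucc),
          Function.update φ k.castSucc c (Fin.last n) = φ (Fin.last n) := fun c =>
        Function.update_of_ne (Fin.castSucc_lt_last k).ne' _ _
      rw [h, h, h]
      exact ih (Fin.init φ) k a b _

/-- Contracting the other variables of a positive multilinear operator `S` into `G*` with positive
functionals gives a positive linear operator `E_1 → G*`, and the contraction commutes with all
`ψ ∈ G**` if the operators from the other `E_i` into `G*` are weakly compact. -/
theorem exists_arensForm_comp_eq {n : ℕ} {E : Fin (n + 1) → Type*}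
    [∀ i, NormedAddCommGroup (E i)] [∀ i, NormedSpace ℝ (E i)] [∀ i, Lattice (E i)]
    [∀ i, IsOrderedAddMonoid (E i)] {G : Type*} [NormedAddCommGroup G] [NormedSpace ℝ G]
    [Preorder G]
    (hc : ∀ j : Fin (n + 1), 0 < (j : ℕ) → ∀ T : E j →L[ℝ] StrongDual ℝ G,
      IsRegularLinear T → IsWeaklyCompactOperator T)
    {φ : ∀ i, Bidual (E i)} (hφ : ∀ i, 0 ≤ φ i)
    (S : ContinuousMultilinearMap ℝ E (StrongDual ℝ G)) (hS : ∀ x, (∀ i, 0 ≤ x i) → 0 ≤ S x) :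
    ∃ T : E 0 →L[ℝ] StrongDual ℝ G, (∀ x, 0 ≤ x → 0 ≤ T x) ∧
      ∀ ψ : Bidual G, arensForm (n + 1) φ (ψ.compContinuousMultilinearMap S) = φ 0 (ψ.comp T) := by
  induction n with
  | zero =>
    exact ⟨S.curryRight fun i => i.elim0,
      fun x hx => hS _ (snoc_nonneg (fun i => i.elim0) hx), fun ψ => rfl⟩
  | succ n ih =>
    -- `L R = φ_last ∘ R.flip`: it contracts the last variable of `E` while leaving the variable in
    -- `G` free, so the induction hypothesis applies to a positive operator into `G*` with one
    -- variable fewer.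
    let L : (E (Fin.last (n + 1)) →L[ℝ] StrongDual ℝ G) →L[ℝ] StrongDual ℝ G :=
      (ContinuousLinearMap.compL ℝ G (StrongDual ℝ (E (Fin.last (n + 1)))) ℝ
        (φ (Fin.last (n + 1)))).comp
        (ContinuousLinearMap.flipₗᵢ ℝ (E (Fin.last (n + 1))) G
          ℝ).toContinuousLinearEquiv.toContinuousLinearMap
    obtain ⟨T, hT, hTe⟩ := ih (fun j hj => hc j.castSucc hj) (fun i => hφ i.castSucc)
      (L.compContinuousMultilinearMap S.curryRight) fun x hx g hg =>
        hφ _ _ fun z hz => hS _ (snoc_nonneg hx hz) g hg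
    refine ⟨T, hT, fun ψ => (Eq.trans ?_ (hTe ψ))⟩
    rw [arensForm_succ]
    congr 1
    ext x
    -- This is the exchange `φ_last (ψ ∘ R) = ψ (φ_last ∘ R.flip)` for `R = S (x, •)`, which is
    -- regular even when `x` is not positive.
    exact (hc _ (Nat.succ_pos n) (S.curryRight x) (isRegularLinear_apply
      S.curryRight.toMultilinearMap
      (fun x hx z hz => hS _ (snoc_nonneg hx hz)) x)).apply_comp_comm _ ψ

/-- The scalar core of the theorem, by induction on the number of variables. If the moving variable
is not last, contracting the last one with a positive functional keeps the form positive. If it is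
last, exchanging contractions reduces to a positive operator on `E 0`, to which `ho` applies. With
one variable only, the net is evaluated at a positive element of the dual. -/
theorem exists_arensForm_update_lt {n : ℕ} {E : Fin (n + 1) → Type*}
    [∀ i, NormedAddCommGroup (E i)] [∀ i, NormedSpace ℝ (E i)] [∀ i, Lattice (E i)]
    [∀ i, IsOrderedAddMonoid (E i)] [∀ i, HasSolidNorm (E i)]
    {ι : Type*} [Preorder ι] [IsDirectedOrder ι] [Nonempty ι]
    (hc : ∀ j k : Fin (n + 1), 0 < (j : ℕ) → j < k → ∀ T : E j →L[ℝ] StrongDual ℝ (E k),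
      IsRegularLinear T → IsWeaklyCompactOperator T)
    (ho : ∀ k : Fin (n + 1), 0 < (k : ℕ) → ∀ (φ : Bidual (E 0)) (T : E 0 →L[ℝ] StrongDual ℝ (E k)),
      IsRegularLinear T → ∀ y : ι → Bidual (E k), Antitone y → IsGLB (Set.range y) 0 →
        ∀ ε > 0, ∃ i, φ ((y i).comp T) < ε)
    {φ : ∀ i, Bidual (E i)} (hφ : ∀ i, 0 ≤ φ i) (B : ContinuousMultilinearMap ℝ E ℝ)
    (hB : ∀ x, (∀ i, 0 ≤ x i) → 0 ≤ B x) (j : Fin (n + 1)) {y : ι → Bidual (E j)}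
    (hy : Antitone y) (hy0 : IsGLB (Set.range y) 0) {ε : ℝ} (hε : 0 < ε) :
    ∃ i, arensForm (n + 1) (Function.update φ j (y i)) B < ε := by
  induction n with
  | zero =>
    obtain rfl : j = Fin.last 0 := Subsingleton.elim (α := Fin 1) _ _
    have hE : HasBoundedPosParts (E (Fin.last 0)) := hasBoundedPosParts_of_hasSolidNorm
    obtain ⟨i, hi⟩ := hE.strongDual.exists_apply_lt hy hy0 (x := B.curryRight fun i => i.elim0)
      (fun x hx => hB _ (snoc_nonneg (fun i => i.elim0) hx)) hε
    refine ⟨i, lt_of_eq_of_lt ?_ hi⟩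
    rw [arensForm_succ, Function.update_self]
    rfl
  | succ n ih =>
    simp only [arensForm_succ (n := n + 1)]
    induction j using Fin.lastCases with
    | last =>
      obtain ⟨T, hT, hTe⟩ := exists_arensForm_comp_eq (E := fun i : Fin (n + 1) => E i.castSucc)
        (fun j hj => hc j.castSucc (Fin.last (n + 1)) hj (Fin.castSucc_lt_last j))
        (φ := Fin.init φ) (fun i => hφ i.castSucc) B.curryRight
        (fun x hx z hz => hB _ (snoc_nonneg hx hz))
      obtain ⟨i, hi⟩ := ho (Fin.last (n + 1)) (Nat.succ_pos n) (φ 0) T (.of_nonneg hT) y hy hy0 ε hε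
      refine ⟨i, lt_of_eq_of_lt ?_ hi⟩
      rw [Fin.init_update_last, Function.update_self]
      exact hTe (y i)
    | cast j =>
      obtain ⟨i, hi⟩ := ih (E := fun i : Fin (n + 1) => E i.castSucc)
        (fun j k hj hjk => hc j.castSucc k.castSucc hj hjk)
        (fun k hk => ho k.castSucc hk) (φ := Fin.init φ) (fun i => hφ i.castSucc)
        (contractLast (φ (Fin.last (n + 1))) B) (contractLast_nonneg (hφ _) hB) j hy hy0
      refine ⟨i, lt_of_eq_of_lt ?_ hi⟩
      rw [Fin.init_update_castSucc, Function.update_of_ne (Fin.castSucc_lt_last j).ne']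

end Arens

/-! ### Order continuity tested on decreasing nets -/

section OrderContinuity

/-- Removes the dependence on the universe of the index set: a decreasing net can be replaced by its
range with the reversed order, which lives in the universe of `X`. -/
theorem IsOrderContinuous.exists_apply_lt.{s, a} {X : Type a} [AddCommGroup X] [Preorder X]
    [IsOrderedAddMonoid X] {f : X → ℝ} (hf : IsOrderContinuous.{a} f) {ι : Type s} [Preorder ι]
    [IsDirectedOrder ι] [Nonempty ι] {y : ι → X} (hy : Antitone y)
    (hy0 : IsGLB (Set.range y) 0) {ε : ℝ} (hε : 0 < ε) : ∃ i, f (y i) < ε := by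
  have hdir : IsDirectedOrder (Set.range y)ᵒᵈ := ⟨by
    rintro ⟨_, i, rfl⟩ ⟨_, k, rfl⟩
    obtain ⟨n, hin, hkn⟩ := exists_ge_ge i k
    exact ⟨⟨y n, n, rfl⟩, hy hin, hy hkn⟩⟩
  have hne : Nonempty (Set.range y)ᵒᵈ := (Set.range_nonempty y).to_subtype
  obtain ⟨z, -, hz0, hz⟩ := hf (Set.range y)ᵒᵈ (fun d => ((OrderDual.ofDual d : Set.range y) : X))
    ⟨fun d => ((OrderDual.ofDual d : Set.range y) : X), fun a b h => h, by
      have : Set.range (fun d : (Set.range y)ᵒᵈ => ((OrderDual.ofDual d : Set.range y) : X)) =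
          Set.range y :=
        Subtype.range_coe
      rwa [this], fun d => by
        have h0 : 0 ≤ ((OrderDual.ofDual d : Set.range y) : X) := hy0.1 (OrderDual.ofDual d).2
        exact ⟨le_rfl, (neg_nonpos.2 h0).trans h0⟩⟩
  obtain ⟨_, ⟨d, rfl⟩, -, hd⟩ := hz0.exists_between hε
  obtain ⟨i, hi⟩ := (OrderDual.ofDual d).2
  refine ⟨i, ?_⟩
  rw [hi]
  exact (hz d).1.trans_lt hd

theorem OrderNull.sub {ι Y : Type*} [Preorder ι] [IsDirectedOrder ι] [AddCommGroup Y] [Preorder Y]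
    [IsOrderedAddMonoid Y] {a b : ι → Y} (ha : OrderNull a) (hb : OrderNull b) :
    OrderNull fun i => a i - b i := by
  obtain ⟨y, hy, hy0, hay⟩ := ha
  obtain ⟨z, hz, hz0, hbz⟩ := hb
  refine ⟨fun i => y i + z i, hy.add hz, ⟨?_, fun l hl => ?_⟩, fun i => ⟨?_, ?_⟩⟩
  · rintro _ ⟨i, rfl⟩
    exact add_nonneg (hy0.1 ⟨i, rfl⟩) (hz0.1 ⟨i, rfl⟩)
  · refine hz0.2 ?_
    rintro _ ⟨k, rfl⟩
    -- A lower bound `l` of `y + z` satisfies `l - z k ≤ y i` for all `i` and `k`, by passing to a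
    -- common later index; the two infima are then taken one after the other.
    rw [← sub_nonpos]
    refine hy0.2 ?_
    rintro _ ⟨i, rfl⟩
    obtain ⟨n, hin, hkn⟩ := exists_ge_ge i k
    exact sub_le_iff_le_add.2 ((hl ⟨n, rfl⟩).trans (add_le_add (hy hin) (hz hkn)))
  · beta_reduce
    rw [sub_eq_add_neg]
    exact add_le_add (hay i).1 (hbz i).2
  · beta_reduce
    rw [neg_sub', sub_neg_eq_add]
    exact add_le_add (hay i).2 (hbz i).1

theorem IsOrderContinuous.sub.{s, a, b} {X : Type a} {Y : Type b} [AddCommGroup X] [Preorder X]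
    [AddCommGroup Y] [Preorder Y] [IsOrderedAddMonoid Y] {f g : X → Y}
    (hf : IsOrderContinuous.{s} f) (hg : IsOrderContinuous.{s} g) :
    IsOrderContinuous.{s} fun x => f x - g x :=
  fun ι _ _ _ x hx => (hf ι x hx).sub (hg ι x hx)

/-- A positive operator into a dual space is order continuous if it maps nets decreasing to `0`
to nets converging to `0` at all positive points. -/
theorem isOrderContinuous_of_exists_apply_lt.{s, a, b} {X : Type a} [AddCommGroup X] [Preorder X]
    [IsOrderedAddMonoid X] {Z : Type b} [NormedAddCommGroup Z] [NormedSpace ℝ Z] [Preorder Z]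
    (S : X → StrongDual ℝ Z) (hsub : ∀ x y, S (x - y) = S x - S y) (hpos : ∀ x, 0 ≤ x → 0 ≤ S x)
    (hS : ∀ (ι : Type s) [Preorder ι] [IsDirectedOrder ι] [Nonempty ι] (y : ι → X), Antitone y →
      IsGLB (Set.range y) 0 → ∀ f : Z, 0 ≤ f → ∀ ε > 0, ∃ i, S (y i) f < ε) :
    IsOrderContinuous.{s} S := by
  have hmono : Monotone S := fun x y h => by
    have h1 := hpos (y - x) (sub_nonneg.2 h)
    rw [hsub] at h1
    exact sub_nonneg.1 h1
  have hneg : ∀ x, S (-x) = -S x := fun x => by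
    have h0 : S 0 = 0 := by simpa using hsub 0 0
    rw [← zero_sub, hsub, h0, zero_sub]
  rintro ι _ _ _ x ⟨y, hy, hy0, hxy⟩
  refine ⟨fun i => S (y i), hmono.comp_antitone hy, ⟨?_, fun l hl f hf => ?_⟩,
    fun i => ⟨hmono (hxy i).1, ?_⟩⟩
  · rintro _ ⟨i, rfl⟩
    exact hpos _ (hy0.1 ⟨i, rfl⟩)
  · refine le_of_forall_pos_lt_add fun ε hε => ?_
    obtain ⟨i, hi⟩ := hS ι y hy hy0 f hf ε hε
    rw [zero_apply, zero_add]
    exact (hl ⟨i, rfl⟩ f hf).trans_lt hi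
  · rw [← hneg]
    exact hmono (hxy i).2

end OrderContinuity

/-! ### Reduction to positive operators and positive fixed functionals -/

section MainTheorem

theorem isOrderContinuous_arensExtension_of_nonneg {n : ℕ} {E : Fin (n + 1) → Type u}
    [∀ i, NormedAddCommGroup (E i)] [∀ i, NormedSpace ℝ (E i)] [∀ i, Lattice (E i)]
    [∀ i, IsOrderedAddMonoid (E i)] [∀ i, HasSolidNorm (E i)]
    (hc : ∀ j k : Fin (n + 1), 0 < (j : ℕ) → j < k → ∀ T : E j →L[ℝ] StrongDual ℝ (E k),
      IsRegularLinear T → IsWeaklyCompactOperator T)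
    (ho : ∀ k : Fin (n + 1), 0 < (k : ℕ) → ∀ (φ : Bidual (E 0)) (T : E 0 →L[ℝ] StrongDual ℝ (E k)),
      IsRegularLinear T → IsOrderContinuous.{u} fun ψ : Bidual (E k) => biadjoint T φ ψ)
    {F : Type v} [NormedAddCommGroup F] [NormedSpace ℝ F] [Preorder F]
    (A : ContinuousMultilinearMap ℝ E F) (hA : ∀ x, (∀ i, 0 ≤ x i) → 0 ≤ A x)
    (j : Fin (n + 1)) {φ : ∀ i, Bidual (E i)} (hφ : ∀ i, i ≠ j → 0 ≤ φ i) :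
    IsOrderContinuous.{w} fun z : Bidual (E j) => arensExtension A (Function.update φ j z) := by
  have hupd : ∀ z, 0 ≤ z → ∀ i, 0 ≤ Function.update φ j z i := fun z hz i => by
    by_cases h : i = j
    · subst h
      rwa [Function.update_self]
    · rw [Function.update_of_ne h]
      exact hφ i h
  have hB : ∀ f : StrongDual ℝ F, 0 ≤ f → ∀ x, (∀ i, 0 ≤ x i) →
      0 ≤ f.compContinuousMultilinearMap A x := fun f hf x hx => hf _ (hA x hx)
  refine isOrderContinuous_of_exists_apply_lt _ (fun a b => ?_) (fun z hz f hf => ?_)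
    fun ι _ _ _ y hy hy0 f hf ε hε => ?_
  · ext f
    exact arensForm_update_sub φ j a b _
  · exact arensForm_nonneg (hupd z hz) (hB f hf)
  -- Nothing is known about the sign of `φ j`, so it is replaced by 0 to have all coordinates
  -- positive; the later update by `y i` overwrites it.
  · obtain ⟨i, hi⟩ := exists_arensForm_update_lt hc
      (fun k hk φ T hT y hy hy0 ε hε => (ho k hk φ T hT).exists_apply_lt hy hy0 hε)
      (hupd 0 le_rfl) _ (hB f hf) j hy hy0 hε
    refine ⟨i, ?_⟩
    rwa [Function.update_idem] at hi

theorem isSeparatelyOrderContinuous_arensExtension_of_nonneg {n : ℕ} {E : Fin (n + 1) → Type u}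
    [∀ i, NormedAddCommGroup (E i)] [∀ i, NormedSpace ℝ (E i)] [∀ i, Lattice (E i)]
    [∀ i, IsOrderedAddMonoid (E i)] [∀ i, HasSolidNorm (E i)]
    (hc : ∀ j k : Fin (n + 1), 0 < (j : ℕ) → j < k → ∀ T : E j →L[ℝ] StrongDual ℝ (E k),
      IsRegularLinear T → IsWeaklyCompactOperator T)
    (ho : ∀ k : Fin (n + 1), 0 < (k : ℕ) → ∀ (φ : Bidual (E 0)) (T : E 0 →L[ℝ] StrongDual ℝ (E k)),
      IsRegularLinear T → IsOrderContinuous.{u} fun ψ : Bidual (E k) => biadjoint T φ ψ)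
    {F : Type v} [NormedAddCommGroup F] [NormedSpace ℝ F] [Preorder F]
    (A : ContinuousMultilinearMap ℝ E F) (hA : ∀ x, (∀ i, 0 ≤ x i) → 0 ≤ A x) :
    IsSeparatelyOrderContinuous.{w} (arensExtension A) := by
  intro j φ
  -- Induction on a set `s` of coordinates of unknown sign: splitting one of them as `p - q` writes
  -- the map as a difference of two maps with fewer such coordinates.
  have key : ∀ (s : Finset (Fin (n + 1))) (φ : ∀ i, Bidual (E i)), (∀ i, i ≠ j → i ∉ s → 0 ≤ φ i) →
      IsOrderContinuous.{w} fun z : Bidual (E j) =>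
        arensExtension A (Function.update φ j z) := by
    intro s
    induction s using Finset.induction_on with
    | empty =>
      exact fun φ hφ => isOrderContinuous_arensExtension_of_nonneg hc ho A hA j
        fun i hi => hφ i hi (Finset.notMem_empty i)
    | insert a s _ ih =>
      intro φ hφ
      by_cases haj : a = j
      · subst haj
        exact ih φ fun i hi his => hφ i hi (by simp [hi, his])
      · obtain ⟨C, -, hC⟩ :=
          (hasBoundedPosParts_of_hasSolidNorm (E := E a)).strongDual.strongDual.exists_sub
        obtain ⟨p, q, hp, hq, hpq, -, -⟩ := hC (φ a)
        have hpos : ∀ r : Bidual (E a), 0 ≤ r → ∀ i, i ≠ j → i ∉ s →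
            0 ≤ Function.update φ a r i := fun r hr i hi his => by
          by_cases h : i = a
          · subst h
            rwa [Function.update_self]
          · rw [Function.update_of_ne h]
            exact hφ i hi (by simp [h, his])
        convert (ih _ (hpos p hp)).sub (ih _ (hpos q hq)) using 2 with z
        rw [Function.update_comm haj, Function.update_comm haj]
        ext f
        refine Eq.trans ?_ (arensForm_update_sub (Function.update φ j z) a p q _)
        rw [← hpq, Function.update_comm (Ne.symm haj), Function.update_eq_self]
        rfl
  exact key Finset.univ φ fun i _ hi => absurd (Finset.mem_univ i) hi

theorem arensExtension_sub {n : ℕ} {E : Fin n → Type*} [∀ i, NormedAddCommGroup (E i)]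
    [∀ i, NormedSpace ℝ (E i)] {F : Type*} [NormedAddCommGroup F] [NormedSpace ℝ F]
    (P Q : ContinuousMultilinearMap ℝ E F) (φ : ∀ i, Bidual (E i)) :
    arensExtension (P - Q) φ = arensExtension P φ - arensExtension Q φ := by
  simp only [arensExtension, map_sub, ContinuousLinearMap.comp_sub]

end MainTheorem

end ArensExtension

theorem mainTheorem9 (m : ℕ) (hm : 2 ≤ m) (E : Fin m → Type u)
    [∀ i, NormedAddCommGroup (E i)] [∀ i, NormedSpace ℝ (E i)] [∀ i, CompleteSpace (E i)]
    [∀ i, Lattice (E i)] [∀ i, IsOrderedAddMonoid (E i)] [∀ i, IsOrderedModule ℝ (E i)]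
    [∀ i, HasSolidNorm (E i)]
    (h_compact : ∀ j k : Fin m, 0 < (j : ℕ) → j < k → ∀ T : E j →L[ℝ] StrongDual ℝ (E k),
      IsRegularLinear T → IsWeaklyCompactOperator T)
    (h_order : ∀ k : Fin m, 0 < (k : ℕ) →
      ∀ (φ : Bidual (E ⟨0, by omega⟩)) (T : E ⟨0, by omega⟩ →L[ℝ] StrongDual ℝ (E k)),
        IsRegularLinear T →
          IsOrderContinuous.{u} fun ψ : Bidual (E k) => biadjoint T φ ψ)
    (F : Type v) [NormedAddCommGroup F] [NormedSpace ℝ F] [CompleteSpace F]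
    [Lattice F] [IsOrderedAddMonoid F] [IsOrderedModule ℝ F] [HasSolidNorm F]
    (A : MultilinearMap ℝ E F) (hA : IsRegularMultilinear A) :
    IsSeparatelyOrderContinuous.{w} (arensExtension hA.toContinuous) := by
  obtain ⟨n, rfl⟩ : ∃ n, m = n + 1 := ⟨m - 1, by omega⟩
  obtain ⟨P, Q, hP, hQ, hPQ⟩ := id hA
  have hP' : IsRegularMultilinear P := ⟨P, 0, hP, fun _ _ => le_rfl, by simp⟩
  have hQ' : IsRegularMultilinear Q := ⟨Q, 0, hQ, fun _ _ => le_rfl, by simp⟩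
  -- Positive operators on Banach lattices are automatically continuous, so the decomposition holds
  -- among bounded operators.
  have h : hA.toContinuous = hP'.toContinuous - hQ'.toContinuous := by
    ext x
    exact DFunLike.congr_fun hPQ x
  intro j φ
  simp only [h, arensExtension_sub]
  exact (isSeparatelyOrderContinuous_arensExtension_of_nonneg h_compact h_order hP'.toContinuous hP
    j φ).sub (isSeparatelyOrderContinuous_arensExtension_of_nonneg h_compact h_order
      hQ'.toContinuous hQ j φ)
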